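/- **Setting.** Let $V$ be a finite set. A *mixed graph* on $V$ has directed edges $u\to v$ and undirected edges $u-v$, no loops, and at most one edge between two vertices. It is a *chain graph* if there is no partially directed path from a vertex $u$ to a vertex $v$ (a path along undirected edges in any direction and directed edges in their direction) together with an edge $v\to u$. Its *blocks* are the connected components of its undirected part; $\mathcal B(G)$ is the set of blocks of $G$, and $\mathrm{pa}_G(A)=\{u: u\to v\text{ for some }v\in A\}$, $\mathrm{fa}_G(A)=\mathrm{pa}_G(A)\cup A$, and $\mathrm{nb}_G(v)=\{u:u-v\}$. For a block $B$ of $G$, the moralised graph $(G_{\mathrm{fa}_G(B)})^a$ is the undirected graph with vertex set $\mathrm{fa}_G(B)$ in which two distinct vertices are joined if they are adjacent in $G$ or both lie in $\mathrm{pa}_G(B)\setminus B$. Every $v\in V$ has a countable (finite or infinite) discrete state space $\mathfrak X_v$; write $\mathfrak X_A=\prod_{v\in A}\mathfrak X_v$. **Chain graph causal model.** Let $G^*$ be a chain graph on $V$ in which any two distinct vertices are adjacent, and let $G$ be a chain graph obtained from $G^*$ by deleting edges. On some probability space, for every $B\in\mathcal B(G^*)$ and every $a\in\mathfrak X_{\mathrm{pa}_{G^*}(B)}$,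 let a random vector $B(a)=(v(a))_{v\in B}$ with values in $\mathfrak X_B$ (the one step ahead block) be given, such that 1. the families $\{B(a): a\in\mathfrak X_{\mathrm{pa}_{G^*}(B)}\}$, $B\in\mathcal B(G^*)$, are mutually independent; 2. $P(B(a)=b)>0$ for all $B\in\mathcal B(G^*)$, $a\in\mathfrak X_{\mathrm{pa}_{G^*}(B)}$, $b\in\mathfrak X_B$; 3. for every $B\in\mathcal B(G^*)$ and $v\in B$, the conditional probability $P\big(v(a)=b_v \mid u(a)=b_u \text{ for all } u\in B\setminus\{v\}\big)$, as a function of $a\in\mathfrak X_{\mathrm{pa}_{G^*}(B)}$ and $b\in\mathfrak X_B$, depends only on $a_{\mathrm{pa}_G(v)}$, $b_v$ and $b_{\mathrm{nb}_G(v)}$. The observed vector $\vec V$ is defined by recursive substitution: for every $B\in\mathcal B(G^*)$, $\vec V_B=B(\vec V_{\mathrm{pa}_{G^*}(B)})$. **Claim.** There are functions $\phi_C:\mathfrak X_C\to[0,\infty)$ for $C\subseteq V$, and $Z_B:\mathfrak X_{\mathrm{pa}_G(B)}\to(0,\infty)$ for $B\in\mathcal B(G)$, such that for all $x\in\mathfrak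 X_V$ $$P(\vec V=x)=\prod_{B\in\mathcal B(G)}\frac1{Z_B(x_{\mathrm{pa}_G(B)})}\prod_{C\in\mathcal C_B}\phi_C(x_C),$$ where $\mathcal C_B$ is the set of maximal cliques $C$ of $(G_{\mathrm{fa}_G(B)})^a$ with $C\not\subseteq\mathrm{pa}_G(B)$. Moreover each $Z_B$ is the normalising function of its block: for every $B\in\mathcal B(G)$ and $a\in\mathfrak X_{\mathrm{pa}_G(B)}$, $Z_B(a)=\sum_{b\in\mathfrak X_B}\prod_{C\in\mathcal C_B}\phi_C\big((a,b)_C\big)$, with a convergent sum. -/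

import Mathlib

open MeasureTheory ProbabilityTheory

/-- A mixed graph with directed edges `u → v` (`dir u v`) and undirected edges `u - v`
(`undir.Adj u v`), without loops and with at most one edge between any two vertices. -/
structure MixedGraph (V : Type*) where
  dir : V → V → Prop
  undir : SimpleGraph V
  dir_asymm : ∀ u v, dir u v → ¬ dir v u
  not_dir_of_undir : ∀ u v, undir.Adj u v → ¬ dir u v

namespace MixedGraph

variable {V : Type*}

/-- `u` and `v` are joined by an edge of some kind. -/
def Adj (G : MixedGraph V) (u v : V) : Prop :=
  G.dir u v ∨ G.dir v u ∨ G.undir.Adj u v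

/-- One step of a partially directed path: along an undirected edge, or along a directed edge
in its direction. -/
def Step (G : MixedGraph V) (u v : V) : Prop :=
  G.dir u v ∨ G.undir.Adj u v

/-- Any two distinct vertices are adjacent. -/
def IsComplete (G : MixedGraph V) : Prop :=
  ∀ u v, u ≠ v → G.Adj u v

/-- `H.IsEdgeSubgraph G`: the mixed graph `H` arises from `G` by deleting edges. -/
def IsEdgeSubgraph (H G : MixedGraph V) : Prop :=
  (∀ u v, H.dir u v → G.dir u v) ∧ (∀ u v, H.undir.Adj u v → G.undir.Adj u v)

end MixedGraph

/-- A chain graph: a mixed graph without partially directed cycles, that is, without a partially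
directed path from `u` to `v` together with a directed edge `v → u`.  (There is a partially
directed path from `u` to `v` iff `v` can be reached from `u` by finitely many steps, since
repeated vertices can be cut out.) -/
structure ChainGraph (V : Type*) extends MixedGraph V where
  no_cycle : ∀ u v, Relation.ReflTransGen toMixedGraph.Step u v → ¬ dir v u

namespace ChainGraph

section Graph

variable {V : Type*} [Fintype V] [DecidableEq V] (G : ChainGraph V)

open Classical in
/-- The block of `v`: its connected component when all directed edges are dropped. -/
noncomputable def block (v : V) : Finset V :=
  Finset.univ.filter fun u => G.undir.Reachable v u

/-- The set of blocks. -/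
noncomputable def blocks : Finset (Finset V) :=
  Finset.univ.image G.block

/-- A block, as an element of a type. -/
abbrev Block : Type _ := {B : Finset V // B ∈ G.blocks}

open Classical in
/-- The set of parents of a set of vertices. -/
noncomputable def pa (A : Finset V) : Finset V :=
  Finset.univ.filter fun u => ∃ v ∈ A, G.dir u v

/-- The family of a set of vertices. -/
noncomputable def fa (A : Finset V) : Finset V :=
  G.pa A ∪ A

/-- The augmented (moralised) graph of the family of `B`.  Its vertices are those of `fa B`; two
of them are joined if they are adjacent in the chain graph or both are parents of `B` outside
`B`. -/
def augmented (B : Finset V) : SimpleGraph V where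
  Adj u v := u ≠ v ∧ u ∈ G.fa B ∧ v ∈ G.fa B ∧
    (G.Adj u v ∨ (u ∈ G.pa B \ B ∧ v ∈ G.pa B \ B))
  symm := ⟨by
    rintro u v ⟨h, hu, hv, h'⟩
    refine ⟨h.symm, hv, hu, ?_⟩
    rcases h' with (h' | h' | h') | h'
    · exact Or.inl (Or.inr (Or.inl h'))
    · exact Or.inl (Or.inl h')
    · exact Or.inl (Or.inr (Or.inr h'.symm))
    · exact Or.inr ⟨h'.2, h'.1⟩⟩
  loopless := ⟨fun _ h => h.1 rfl⟩

open Classical in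
/-- The maximal cliques of the augmented graph of the family of `B`. -/
noncomputable def maxCliques (B : Finset V) : Finset (Finset V) :=
  Finset.univ.filter fun C =>
    Maximal (fun S : Finset V => S ⊆ G.fa B ∧ (G.augmented B).IsClique (S : Set V)) C

/-- The maximal cliques of the augmented graph of the family of `B` that are not contained in the
set of parents of `B`. -/
noncomputable def factorCliques (B : Finset V) : Finset (Finset V) :=
  (G.maxCliques B).filter fun C => ¬ C ⊆ G.pa B

theorem mem_block {u v : V} : u ∈ G.block v ↔ G.undir.Reachable v u := by
  simp [block]

theorem block_mem_blocks (v : V) : G.block v ∈ G.blocks :=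
  Finset.mem_image_of_mem _ (Finset.mem_univ v)

theorem block_eq_of_mem {B : Finset V} (hB : B ∈ G.blocks) {v : V} (hv : v ∈ B) :
    G.block v = B := by
  obtain ⟨w, -, rfl⟩ := Finset.mem_image.1 hB
  have h := G.mem_block.1 hv
  ext u
  rw [mem_block, mem_block]
  exact ⟨fun h' => h.trans h', fun h' => h.symm.trans h'⟩

/-- Passing from a vertex to the parents of its block terminates. -/
theorem wellFounded_pa : WellFounded fun u v : V => u ∈ G.pa (G.block v) := by
  have key : ∀ u v : V, Relation.TransGen (fun u v : V => u ∈ G.pa (G.block v)) u v →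
      ∃ b, G.dir u b ∧ Relation.ReflTransGen G.toMixedGraph.Step b v := by
    have one : ∀ u v : V, u ∈ G.pa (G.block v) →
        ∃ b, G.dir u b ∧ Relation.ReflTransGen G.toMixedGraph.Step b v := by
      intro u v h
      simp only [pa, Finset.mem_filter, Finset.mem_univ, true_and] at h
      obtain ⟨b, hb, hd⟩ := h
      have hr := (G.mem_block.1 hb).symm
      rw [SimpleGraph.reachable_iff_reflTransGen] at hr
      exact ⟨b, hd, Relation.ReflTransGen.mono (fun _ _ h' => Or.inr h') _ _ hr⟩
    intro u v h
    induction h with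
    | single h => exact one _ _ h
    | tail _ h ih =>
      obtain ⟨b, hb, hr⟩ := ih
      obtain ⟨c, hc, hr'⟩ := one _ _ h
      exact ⟨b, hb, (hr.tail (Or.inl hc)).trans hr'⟩
  have hirr : Std.Irrefl (Relation.TransGen fun u v : V => u ∈ G.pa (G.block v)) := by
    constructor
    intro u h
    obtain ⟨b, hb, hr⟩ := key u u h
    exact G.no_cycle b u hr hb
  have := Finite.wellFounded_of_trans_of_irrefl
    (Relation.TransGen fun u v : V => u ∈ G.pa (G.block v))
  exact Subrelation.wf (fun h => Relation.TransGen.single h) this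

end Graph

section Model

variable {V : Type*} [Fintype V] [DecidableEq V]

/-- One step ahead blocks: for every block `B` and every assignment `a` of values to the parents
of `B`, a random vector `Y B a` of potential outcomes, indexed by the elements of `B`. -/
abbrev OneStepAhead (G : ChainGraph V) (X : V → Type*) (Ω : Type*) : Type _ :=
  (B : G.Block) → ((u : G.pa B.1) → X u) → Ω → ((v : B.1) → X v)

variable {X : V → Type*} {Ω : Type*}

/-- The observed variables, obtained from the one step ahead blocks by recursive substitution. -/
noncomputable def observed (G : ChainGraph V) (Y : OneStepAhead G X Ω) (ω : Ω) : (v : V) → X v :=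
  G.wellFounded_pa.fix fun v rec =>
    Y ⟨G.block v, G.block_mem_blocks v⟩ (fun u => rec u.1 u.2) ω
      ⟨v, G.mem_block.2 (SimpleGraph.Reachable.refl v)⟩

/-- The observed variables satisfy the equation of recursive substitution: every block takes the
value of its potential outcome at the observed values of its parents. -/
theorem restrict_observed (G : ChainGraph V) (Y : OneStepAhead G X Ω) (ω : Ω) (B : G.Block) :
    B.1.restrict (G.observed Y ω) = Y B ((G.pa B.1).restrict (G.observed Y ω)) ω := by
  obtain ⟨B, hB⟩ := B
  funext ⟨v, hv⟩
  have h := G.block_eq_of_mem hB hv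
  subst h
  simp only [Finset.restrict]
  conv_lhs => rw [observed, WellFounded.fix_eq]
  rfl

/-- The chain graph causal model of `H`, where `H` is an edge subgraph of the complete chain graph
`G` and the potential outcomes are those of the blocks of `G`. -/
structure IsCausalModel [∀ v, MeasurableSpace (X v)] [MeasurableSpace Ω]
    (G H : ChainGraph V) (Y : OneStepAhead G X Ω) (μ : Measure Ω) : Prop where
  /-- Potential outcomes are random vectors. -/
  measurable : ∀ B a, Measurable (Y B a)
  /-- The families `{Y B a | a}`, one for each block `B`, are mutually independent. -/
  indep : iIndepFun (fun (B : G.Block) (ω : Ω) (a : (u : G.pa B.1) → X u) => Y B a ω) μ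
  /-- Every one step ahead block has a positive distribution. -/
  pos : ∀ B a b, 0 < μ {ω | Y B a ω = b}
  /-- Missing edges: for `v` in the block `B`, the conditional probability that the `v`-coordinate
  of `Y B a` is `b v`, given that the other coordinates are as in `b`, is only a function of the
  restriction of `a` to the `H`-parents of `v`, of `b v`, and of the restriction of `b` to the
  `H`-neighbours of `v`. -/
  missing_edges : ∀ (B : G.Block) (v : B.1) (a a' : (u : G.pa B.1) → X u) (b b' : (u : B.1) → X u),
    (∀ u : G.pa B.1, H.dir u v → a u = a' u) →
    b v = b' v →
    (∀ u : B.1, H.undir.Adj v u → b u = b' u) →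
    cond μ {ω | ∀ u, u ≠ v → Y B a ω u = b u} {ω | Y B a ω v = b v} =
      cond μ {ω | ∀ u, u ≠ v → Y B a' ω u = b' u} {ω | Y B a' ω v = b' v}

end Model

end ChainGraph

/-!
By recursive substitution the observed vector equals `x` iff every one step ahead block `K` of the
complete chain graph `Gc` takes the value `x_K` when its parents are set to `x_pa(K)`; independence
of the blocks makes the probability of this event a product of terms `blockProb μ Y K x`
(`measureReal_observed_eq`).  It remains to factorise each term over the blocks of `G` inside `K`.

For this, fix a reference configuration `x₀`.  By a Hammersley–Clifford argument, the logarithm of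
the ratio of `blockProb μ Y K x` to its value with `x_K` reset to the reference is the sum over all
vertex sets `A` of its interactions, Möbius transforms over the lattice of finite sets.  Resetting
the value at `v ∈ K` changes the logarithm by a difference of logarithms of conditional
probabilities of the `v`-coordinate, which by the missing edges only involve `v`, its `G`-neighbours
and its `G`-parents (`blockProb_update_mul`).  So the interaction of `A` vanishes unless `A` meets
`K` and all elements of `A` other than `v` are neighbours or parents of `v`, for each `v ∈ A ∩ K`;
then `A` is a clique of the augmented graph of the block of `v` in `G`
(`exists_factorClique_of_local`), and collecting the interactions by maximal cliques gives the
factors (`exists_blockProb_eq`).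

The factor of a block `B ⊆ K` of `G` does not depend on the values at the other blocks inside `K`.
Summing these out one block at a time shows that the proportionality constant of the factorisation
is the inverse of the product of the normalising sums (`blockProb_eq_prod_div`).  Finally, a factor
clique determines its block (`block_unique_of_mem_factorCliques`), so that the factors of all blocks
can be collected into one family indexed by vertex sets.
-/

/-! ### Möbius inversion and interactions -/

section Moebius

variable {V : Type*} [DecidableEq V]

/-- The Möbius transform of a function `F` of finite sets: the alternating sum
`∑ D ⊆ A, (-1) ^ |A \ D| * F D`. -/
def moebius (F : Finset V → ℝ) (A : Finset V) : ℝ :=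
  ∑ D ∈ A.powerset, (-1) ^ (A \ D).card * F D

theorem moebius_insert (F : Finset V → ℝ) {v : V} {A : Finset V} (hv : v ∉ A) :
    moebius F (insert v A) = moebius (fun D => F (insert v D)) A - moebius F A := by
  unfold moebius
  rw [Finset.sum_powerset_insert hv, add_comm, sub_eq_add_neg, ← Finset.sum_neg_distrib]
  congr 1
  · refine Finset.sum_congr rfl fun D hD => ?_
    have : insert v A \ insert v D = A \ D := by
      ext u
      simp only [Finset.mem_sdiff, Finset.mem_insert]
      by_cases h : u = v
      · subst h; simp [hv]
      · simp [h]
    rw [this]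
  · refine Finset.sum_congr rfl fun D hD => ?_
    have hvD : v ∉ D := fun h => hv (Finset.mem_powerset.1 hD h)
    rw [Finset.insert_sdiff_of_notMem _ hvD, Finset.card_insert_of_notMem (by simp [hv])]
    ring

/-- Möbius inversion on the lattice of subsets of `S`. -/
theorem sum_moebius (F : Finset V → ℝ) (S : Finset V) :
    ∑ A ∈ S.powerset, moebius F A = F S := by
  induction S using Finset.induction_on generalizing F with
  | empty => simp [moebius]
  | insert v S hv ih =>
    rw [Finset.sum_powerset_insert hv]
    have h : ∀ A ∈ S.powerset, moebius F (insert v A) =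
        moebius (fun D => F (insert v D)) A - moebius F A := fun A hA =>
      moebius_insert F fun h => hv (Finset.mem_powerset.1 hA h)
    rw [Finset.sum_congr rfl h, Finset.sum_sub_distrib, ih, ih]
    ring

/-- The Möbius transform vanishes at a set with two elements that do not interact. -/
theorem moebius_eq_zero (F : Finset V → ℝ) {A : Finset V} {v w : V} (hv : v ∈ A) (hw : w ∈ A)
    (hvw : w ≠ v)
    (h : ∀ D, F (insert v (insert w D)) - F (insert w D) = F (insert v D) - F D) :
    moebius F A = 0 := by
  have hA : A = insert w (insert v ((A.erase v).erase w)) := by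
    rw [Finset.insert_comm, Finset.insert_erase (by simp [hw, hvw]), Finset.insert_erase hv]
  rw [hA, moebius_insert _ (by simp [hvw]), moebius_insert _ (by simp), moebius_insert _ (by simp)]
  unfold moebius
  simp only [← Finset.sum_sub_distrib, ← mul_sub]
  refine Finset.sum_eq_zero fun D _ => ?_
  rw [Finset.insert_comm w v, h D]
  ring

theorem moebius_congr {F F' : Finset V → ℝ} {A : Finset V} (h : ∀ D ⊆ A, F D = F' D) :
    moebius F A = moebius F' A :=
  Finset.sum_congr rfl fun D hD => by rw [h D (Finset.mem_powerset.1 hD)]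

variable [Fintype V] {X : V → Type*}

/-- The interaction expansion: if every set with a nonvanishing interaction lies in a member of
`𝒞`, then `f` is a sum of functions of the restrictions to the members of `𝒞`. -/
theorem exists_sum_restrict (x₀ : ∀ v, X v) (f : (∀ v, X v) → ℝ) (𝒞 : Finset (Finset V))
    (h : ∀ A : Finset V, (∃ x, moebius (fun D => f (D.piecewise x x₀)) A ≠ 0) → ∃ C ∈ 𝒞, A ⊆ C) :
    ∃ ψ : (C : Finset V) → ((u : C) → X u) → ℝ,
      ∀ x, f x = ∑ C ∈ 𝒞, ψ C (C.restrict x) := by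
  have h' : ∀ A : Finset V, ∃ C, A ⊆ C ∧
      ((∃ x, moebius (fun D => f (D.piecewise x x₀)) A ≠ 0) → C ∈ 𝒞) := by
    intro A
    by_cases hA : ∃ x, moebius (fun D => f (D.piecewise x x₀)) A ≠ 0
    · obtain ⟨C, hC, hAC⟩ := h A hA
      exact ⟨C, hAC, fun _ => hC⟩
    · exact ⟨A, subset_rfl, fun h => absurd h hA⟩
  -- Each interaction is assigned to one set `M A ⊇ A`, which lies in `𝒞` if it does not vanish.
  choose M hM hM' using h'
  refine ⟨fun C c => ∑ A with M A = C,
    moebius (fun D => f (D.piecewise (Function.updateFinset x₀ C c) x₀)) A, fun x => ?_⟩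
  have hloc : ∀ C ∈ 𝒞, (∑ A with M A = C, moebius (fun D => f (D.piecewise
      (Function.updateFinset x₀ C (C.restrict x)) x₀)) A) =
      ∑ A with M A = C, moebius (fun D => f (D.piecewise x x₀)) A := by
    intro C _
    refine Finset.sum_congr rfl fun A hA => moebius_congr fun D hD => ?_
    have hDC : D ⊆ C := (Finset.mem_filter.1 hA).2 ▸ hD.trans (hM A)
    congr 1
    funext u
    by_cases hu : u ∈ D
    · simp [hu, Function.updateFinset, hDC hu]
    · simp [hu]
  rw [Finset.sum_congr rfl hloc, Finset.sum_fiberwise_eq_sum_filter]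
  have huniv : f x = ∑ A, moebius (fun D => f (D.piecewise x x₀)) A := by
    have := sum_moebius (fun D => f (D.piecewise x x₀)) Finset.univ
    rw [Finset.powerset_univ] at this
    simpa using this.symm
  rw [huniv]
  refine (Finset.sum_filter_of_ne fun A _ hA => hM' A ⟨x, hA⟩).symm

end Moebius

/-! ### Marginal probabilities of discrete random vectors -/

section Marginal

variable {V : Type*} [DecidableEq V] {X : V → Type*}

theorem restrict_updateFinset_of_disjoint {S B : Finset V} (h : Disjoint S B) (x : ∀ v, X v)
    (b : (v : B) → X v) : S.restrict (Function.updateFinset x B b) = S.restrict x := by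
  funext u
  have : (u : V) ∉ B := Finset.disjoint_left.1 h u.2
  simp [Function.updateFinset, this]

variable [∀ v, Countable (X v)] [∀ v, MeasurableSpace (X v)] [∀ v, MeasurableSingletonClass (X v)]
  {Ω : Type*} [MeasurableSpace Ω] {μ : Measure Ω} [IsFiniteMeasure μ]

/-- Summing the probability that `U` agrees with a configuration off `W` over the values of the
configuration at `B` gives the probability of agreement off `W ∪ B`. -/
theorem hasSum_marginal {K : Finset V} {U : Ω → (v : K) → X v} (hU : Measurable U)
    {W B : Finset V} (hBK : B ⊆ K) (hWB : Disjoint B W) (x : ∀ v, X v) :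
    HasSum (fun b : (v : B) → X v =>
        μ.real {ω | ∀ u : K, (u : V) ∉ W → U ω u = Function.updateFinset x B b u})
      (μ.real {ω | ∀ u : K, (u : V) ∉ W ∪ B → U ω u = x u}) := by
  have hset : {ω | ∀ u : K, (u : V) ∉ W ∪ B → U ω u = x u} =
      ⋃ b : (v : B) → X v,
        {ω | ∀ u : K, (u : V) ∉ W → U ω u = Function.updateFinset x B b u} := by
    ext ω
    simp only [Set.mem_ofPred_eq, Set.mem_iUnion]
    constructor
    · intro h
      refine ⟨fun v => U ω ⟨v, hBK v.2⟩, fun u hu => ?_⟩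
      by_cases huB : (u : V) ∈ B
      · simp [Function.updateFinset, huB]
      · simpa [Function.updateFinset, huB] using h u (by simp [hu, huB])
    · rintro ⟨b, hb⟩ u hu
      rw [Finset.mem_union, not_or] at hu
      simpa [Function.updateFinset, hu.2] using hb u hu.1
  have hdisj : Pairwise (Function.onFun Disjoint fun b : (v : B) → X v =>
      {ω | ∀ u : K, (u : V) ∉ W → U ω u = Function.updateFinset x B b u}) := by
    intro b b' hbb'
    refine Set.disjoint_left.2 fun ω h h' => hbb' ?_
    funext v
    have hvW := Finset.disjoint_left.1 hWB v.2
    have h1 := h ⟨v, hBK v.2⟩ hvW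
    have h2 := h' ⟨v, hBK v.2⟩ hvW
    simpa [Function.updateFinset] using h1.symm.trans h2
  have hmeas : ∀ b : (v : B) → X v, MeasurableSet
      {ω | ∀ u : K, (u : V) ∉ W → U ω u = Function.updateFinset x B b u} := by
    intro b
    have : {ω | ∀ u : K, (u : V) ∉ W → U ω u = Function.updateFinset x B b u} =
        ⋂ u : K, ⋂ _ : (u : V) ∉ W,
          (fun ω => U ω u) ⁻¹' {Function.updateFinset x B b u} := by
      ext ω; simp
    rw [this]
    exact MeasurableSet.iInter fun u => MeasurableSet.iInter fun _ =>
      (measurable_pi_apply u).comp hU (measurableSet_singleton _)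
  rw [hset, measureReal_def, measure_iUnion hdisj hmeas]
  have hfin : ∑' b : (v : B) → X v,
      μ {ω | ∀ u : K, (u : V) ∉ W → U ω u = Function.updateFinset x B b u} ≠ ⊤ := by
    rw [← measure_iUnion hdisj hmeas]
    exact measure_ne_top _ _
  rw [ENNReal.tsum_toReal_eq (ENNReal.ne_top_of_tsum_ne_top hfin)]
  exact (ENNReal.summable_toReal hfin).hasSum

end Marginal

/-! ### Blocks and cliques -/

namespace ChainGraph

section Graph

variable {V : Type*} [Fintype V] [DecidableEq V] (G : ChainGraph V)

omit [DecidableEq V] in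
theorem mem_pa {A : Finset V} {u : V} : u ∈ G.pa A ↔ ∃ v ∈ A, G.dir u v := by
  simp [pa]

theorem mem_block_self (v : V) : v ∈ G.block v :=
  G.mem_block.2 (SimpleGraph.Reachable.refl v)

theorem blocks_nonempty {B : Finset V} (hB : B ∈ G.blocks) : B.Nonempty := by
  obtain ⟨w, -, rfl⟩ := Finset.mem_image.1 hB
  exact ⟨w, G.mem_block_self w⟩

theorem blocks_disjoint {B B' : Finset V} (hB : B ∈ G.blocks) (hB' : B' ∈ G.blocks)
    (h : B ≠ B') : Disjoint B B' :=
  Finset.disjoint_left.2 fun _ hv hv' =>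
    h ((G.block_eq_of_mem hB hv).symm.trans (G.block_eq_of_mem hB' hv'))

theorem reflTransGen_of_mem_block {B : Finset V} (hB : B ∈ G.blocks) {u v : V} (hu : u ∈ B)
    (hv : v ∈ B) : Relation.ReflTransGen G.toMixedGraph.Step u v := by
  have h : G.undir.Reachable u v := G.mem_block.1 ((G.block_eq_of_mem hB hu).symm ▸ hv)
  rw [SimpleGraph.reachable_iff_reflTransGen] at h
  exact Relation.ReflTransGen.mono (fun _ _ h' => Or.inr h') _ _ h

/-- No vertex of a block has a parent in the block, since the chain graph has no cycle. -/
theorem disjoint_pa {B : Finset V} (hB : B ∈ G.blocks) : Disjoint (G.pa B) B := by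
  refine Finset.disjoint_left.2 fun u hu huB => ?_
  obtain ⟨v, hv, huv⟩ := G.mem_pa.1 hu
  exact G.no_cycle v u (G.reflTransGen_of_mem_block hB hv huB) huv

/-- If a set `A` meeting the blocks `B` and `B'` lies in the families of both, then `B = B'`:
otherwise `B` and `B'` would contain parents of each other, which closes a cycle. -/
theorem eq_of_subset_fa {B B' A : Finset V} (hB : B ∈ G.blocks) (hB' : B' ∈ G.blocks)
    (hA : A ⊆ G.fa B) (hA' : A ⊆ G.fa B') (hAB : ∃ u ∈ A, u ∈ B) (hAB' : ∃ u ∈ A, u ∈ B') :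
    B = B' := by
  by_contra hne
  obtain ⟨u, huA, huB⟩ := hAB
  obtain ⟨u', huA', huB'⟩ := hAB'
  have hd := Finset.disjoint_left.1 (G.blocks_disjoint hB hB' hne)
  have h1 : u ∈ G.pa B' := (Finset.mem_union.1 (hA' huA)).resolve_right (hd huB)
  have h2 : u' ∈ G.pa B := (Finset.mem_union.1 (hA huA')).resolve_right fun h => hd h huB'
  obtain ⟨w', hw', huw'⟩ := G.mem_pa.1 h1
  obtain ⟨w, hw, huw⟩ := G.mem_pa.1 h2
  exact G.no_cycle w' u (((G.reflTransGen_of_mem_block hB' hw' huB').tail (Or.inl huw)).trans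
    (G.reflTransGen_of_mem_block hB hw huB)) huw'

theorem subset_fa_of_mem_factorCliques {B C : Finset V} (hC : C ∈ G.factorCliques B) :
    C ⊆ G.fa B := by
  simp only [factorCliques, maxCliques, Finset.mem_filter] at hC
  exact hC.1.2.prop.1

theorem exists_mem_of_mem_factorCliques {B C : Finset V} (hC : C ∈ G.factorCliques B) :
    ∃ u ∈ C, u ∈ B := by
  have hfa := G.subset_fa_of_mem_factorCliques hC
  obtain ⟨u, huC, hu⟩ := Finset.not_subset.1 (Finset.mem_filter.1 hC).2
  exact ⟨u, huC, (Finset.mem_union.1 (hfa huC)).resolve_left hu⟩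

/-- A factor clique belongs to only one block. -/
theorem block_unique_of_mem_factorCliques {B B' C : Finset V} (hB : B ∈ G.blocks)
    (hB' : B' ∈ G.blocks) (hC : C ∈ G.factorCliques B) (hC' : C ∈ G.factorCliques B') : B = B' :=
  G.eq_of_subset_fa hB hB' (G.subset_fa_of_mem_factorCliques hC)
    (G.subset_fa_of_mem_factorCliques hC') (G.exists_mem_of_mem_factorCliques hC)
    (G.exists_mem_of_mem_factorCliques hC')

theorem exists_factorClique_superset {B A : Finset V} (hB : B ∈ G.blocks) (hA : A ⊆ G.fa B)
    (hcl : (G.augmented B).IsClique (A : Set V)) (hAB : ∃ u ∈ A, u ∈ B) :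
    ∃ C ∈ G.factorCliques B, A ⊆ C := by
  obtain ⟨C, hAC, hC⟩ := Set.Finite.exists_le_maximal
    (s := {S : Finset V | S ⊆ G.fa B ∧ (G.augmented B).IsClique (S : Set V)})
    (Set.toFinite _) ⟨hA, hcl⟩
  obtain ⟨u, huA, huB⟩ := hAB
  refine ⟨C, ?_, hAC⟩
  simp only [factorCliques, maxCliques, Finset.mem_filter, Finset.mem_univ, true_and]
  exact ⟨hC, fun h => Finset.disjoint_left.1 (G.disjoint_pa hB) (h (hAC huA)) huB⟩

/-- The blocks of `G` inside a set of vertices. -/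
noncomputable def blocksIn (K : Finset V) : Finset (Finset V) :=
  G.blocks.filter (· ⊆ K)

theorem mem_blocksIn {K B : Finset V} : B ∈ G.blocksIn K ↔ B ∈ G.blocks ∧ B ⊆ K :=
  Finset.mem_filter

variable {G} {Gc : ChainGraph V}

theorem block_subset_block (hG : G.toMixedGraph.IsEdgeSubgraph Gc.toMixedGraph) (v : V) :
    G.block v ⊆ Gc.block v := fun _ hu =>
  Gc.mem_block.2 ((G.mem_block.1 hu).mono fun _ _ h => hG.2 _ _ h)

theorem block_mem_blocksIn (hG : G.toMixedGraph.IsEdgeSubgraph Gc.toMixedGraph) {K : Finset V}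
    (hK : K ∈ Gc.blocks) {v : V} (hv : v ∈ K) : G.block v ∈ G.blocksIn K :=
  G.mem_blocksIn.2 ⟨G.block_mem_blocks v,
    (block_subset_block hG v).trans (Gc.block_eq_of_mem hK hv).le⟩

omit [DecidableEq V] in
theorem pa_subset_pa (hG : G.toMixedGraph.IsEdgeSubgraph Gc.toMixedGraph) {B K : Finset V}
    (h : B ⊆ K) : G.pa B ⊆ Gc.pa K := by
  intro u hu
  obtain ⟨v, hv, huv⟩ := G.mem_pa.1 hu
  exact Gc.mem_pa.2 ⟨v, h hv, hG.1 _ _ huv⟩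

theorem eq_of_mem_blocksIn {K K' : Gc.Block} {B : Finset V} (hB : B ∈ G.blocksIn K.1)
    (hB' : B ∈ G.blocksIn K'.1) : K = K' := by
  obtain ⟨hB, hBK⟩ := G.mem_blocksIn.1 hB
  obtain ⟨v, hv⟩ := G.blocks_nonempty hB
  exact Subtype.ext ((Gc.block_eq_of_mem K.2 (hBK hv)).symm.trans
    (Gc.block_eq_of_mem K'.2 ((G.mem_blocksIn.1 hB').2 hv)))

/-- Every block of `G` lies in exactly one block of `Gc`. -/
theorem prod_blocks (hG : G.toMixedGraph.IsEdgeSubgraph Gc.toMixedGraph) (g : Finset V → ℝ) :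
    ∏ B ∈ G.blocks, g B = ∏ K : Gc.Block, ∏ B ∈ G.blocksIn K.1, g B := by
  have hU : G.blocks = Finset.univ.biUnion fun K : Gc.Block => G.blocksIn K.1 := by
    ext B
    simp only [Finset.mem_biUnion, Finset.mem_univ, true_and, mem_blocksIn]
    refine ⟨fun hB => ?_, fun ⟨_, h, _⟩ => h⟩
    obtain ⟨v, hv⟩ := G.blocks_nonempty hB
    exact ⟨⟨Gc.block v, Gc.block_mem_blocks v⟩, hB,
      G.block_eq_of_mem hB hv ▸ block_subset_block hG v⟩
  rw [hU, Finset.prod_biUnion]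
  exact fun K _ K' _ hKK' => Finset.disjoint_left.2 fun B hB hB' =>
    hKK' (eq_of_mem_blocksIn hB hB')

/-- If `A` meets the block `K` of `Gc` and each vertex of `A` in `K` has all others as neighbours or
parents in `G`, then `A` is a clique of the augmented graph of a block of `G` inside `K`: two
vertices of `A` outside `K` are joined there because they have a common child. -/
theorem exists_factorClique_of_local (hG : G.toMixedGraph.IsEdgeSubgraph Gc.toMixedGraph)
    {K A : Finset V} (hK : K ∈ Gc.blocks) (hAK : ∃ v ∈ A, v ∈ K)
    (h : ∀ v ∈ A, v ∈ K → ∀ w ∈ A, w ≠ v → G.undir.Adj v w ∨ G.dir w v) :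
    ∃ C ∈ (G.blocksIn K).biUnion G.factorCliques, A ⊆ C := by
  obtain ⟨v, hvA, hvK⟩ := hAK
  have hB := block_mem_blocksIn hG hK hvK
  obtain ⟨hB', hBK⟩ := G.mem_blocksIn.1 hB
  have hAfa : A ⊆ G.fa (G.block v) := by
    intro w hw
    rw [fa, Finset.mem_union]
    by_cases hwv : w = v
    · exact Or.inr (hwv ▸ G.mem_block_self v)
    · rcases h v hvA hvK w hw hwv with h' | h'
      · exact Or.inr (G.mem_block.2 h'.reachable)
      · exact Or.inl (G.mem_pa.2 ⟨v, G.mem_block_self v, h'⟩)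
  have hout : ∀ w ∈ A, w ∉ K → w ∈ G.pa (G.block v) \ G.block v := fun w hw hwK =>
    Finset.mem_sdiff.2 ⟨(Finset.mem_union.1 (hAfa hw)).resolve_right fun h' => hwK (hBK h'),
      fun h' => hwK (hBK h')⟩
  have hcl : (G.augmented (G.block v)).IsClique (A : Set V) := by
    intro u hu w hw huw
    refine ⟨huw, hAfa hu, hAfa hw, ?_⟩
    by_cases huK : u ∈ K
    · rcases h u hu huK w hw huw.symm with h' | h'
      · exact Or.inl (Or.inr (Or.inr h'))
      · exact Or.inl (Or.inr (Or.inl h'))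
    · by_cases hwK : w ∈ K
      · rcases h w hw hwK u hu huw with h' | h'
        · exact Or.inl (Or.inr (Or.inr h'.symm))
        · exact Or.inl (Or.inl h')
      · exact Or.inr ⟨hout u hu huK, hout w hw hwK⟩
  obtain ⟨C, hC, hAC⟩ := G.exists_factorClique_superset hB' hAfa hcl
    ⟨v, hvA, G.mem_block_self v⟩
  exact ⟨C, Finset.mem_biUnion.2 ⟨_, hB, hC⟩, hAC⟩

end Graph

/-! ### Factorisation of the causal model -/

section Model

variable {V : Type*} [Fintype V] [DecidableEq V] {X : V → Type*} {Ω : Type*} [MeasurableSpace Ω]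

/-- The probability that the potential outcome of the block `K` at the parent values given by `x`
is the one given by `x`. -/
noncomputable def blockProb {Gc : ChainGraph V} (μ : Measure Ω) (Y : OneStepAhead Gc X Ω)
    (K : Gc.Block) (x : ∀ v, X v) : ℝ :=
  μ.real {ω | Y K ((Gc.pa K.1).restrict x) ω = K.1.restrict x}

variable [∀ v, MeasurableSpace (X v)] {μ : Measure Ω} [IsProbabilityMeasure μ]
  {Gc G : ChainGraph V} {Y : OneStepAhead Gc X Ω}

theorem blockProb_pos (hY : IsCausalModel Gc G Y μ) (K : Gc.Block) (x : ∀ v, X v) :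
    0 < blockProb μ Y K x :=
  ENNReal.toReal_pos (hY.pos K _ _).ne' (measure_ne_top _ _)

omit [Fintype V] [∀ v, MeasurableSpace (X v)] in
theorem restrict_update_of_notMem {S : Finset V} {v : V} (hv : v ∉ S) (x : ∀ v, X v) (c : X v) :
    S.restrict (Function.update x v c) = S.restrict x := by
  funext u
  have : (u : V) ≠ v := fun h => hv (h ▸ u.2)
  simp [this]

variable [∀ v, MeasurableSingletonClass (X v)]

/-- The ratio of the probabilities of two outcomes that differ at `v` only depends on the values at
`v` and at its neighbours and parents: it is a ratio of conditional probabilities of the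
`v`-coordinate. -/
theorem blockProb_update_mul (hY : IsCausalModel Gc G Y μ) (K : Gc.Block) {v : V} (hv : v ∈ K.1)
    {x x' : ∀ v, X v} (hxv : x v = x' v)
    (hx : ∀ u, (G.undir.Adj v u ∨ G.dir u v) → x u = x' u) (c : X v) :
    blockProb μ Y K (Function.update x v c) * blockProb μ Y K x' =
      blockProb μ Y K (Function.update x' v c) * blockProb μ Y K x := by
  -- `S y` is the conditioning event, and does not depend on `y v`; `κ y` is the conditional
  -- probability of the value `y v`.
  set S : (∀ v, X v) → Set Ω := fun y =>
    {ω | ∀ u : K.1, u ≠ ⟨v, hv⟩ → Y K ((Gc.pa K.1).restrict y) ω u = K.1.restrict y u} with hS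
  set κ : (∀ v, X v) → ENNReal := fun y => cond μ (S y)
    {ω | Y K ((Gc.pa K.1).restrict y) ω ⟨v, hv⟩ = K.1.restrict y ⟨v, hv⟩} with hκ
  have hvpa : v ∉ Gc.pa K.1 := fun h => Finset.disjoint_left.1 (Gc.disjoint_pa K.2) h hv
  have hSm : ∀ y, MeasurableSet (S y) := by
    intro y
    have : S y = ⋂ u : K.1, ⋂ _ : u ≠ ⟨v, hv⟩,
        (fun ω => Y K ((Gc.pa K.1).restrict y) ω u) ⁻¹' {K.1.restrict y u} := by
      ext ω; simp [hS]
    rw [this]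
    exact MeasurableSet.iInter fun u => MeasurableSet.iInter fun _ =>
      (measurable_pi_apply u).comp (hY.measurable K _) (measurableSet_singleton _)
  have hfac : ∀ y, blockProb μ Y K y = (κ y).toReal * (μ (S y)).toReal := by
    intro y
    rw [← ENNReal.toReal_mul, hκ, cond_mul_eq_inter (hSm y), blockProb, measureReal_def]
    congr 2
    ext ω
    simp only [Set.mem_ofPred_eq, Set.mem_inter_iff, hS]
    constructor
    · intro h
      rw [h]
      exact ⟨fun _ _ => rfl, rfl⟩
    · rintro ⟨h, h'⟩
      funext u
      by_cases hu : u = ⟨v, hv⟩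
      · rw [hu, h']
      · exact h u hu
  have hSu : ∀ y, S (Function.update y v c) = S y := by
    intro y
    simp only [hS, restrict_update_of_notMem hvpa]
    ext ω
    refine forall₂_congr fun u hu => ?_
    have : (u : V) ≠ v := fun h => hu (Subtype.ext h)
    simp [this]
  have hκc : ∀ y y' : ∀ v, X v, y v = y' v →
      (∀ u, (G.undir.Adj v u ∨ G.dir u v) → y u = y' u) → κ y = κ y' := fun y y' hyv hy =>
    hY.missing_edges K ⟨v, hv⟩ _ _ _ _ (fun u hu => hy u (Or.inr hu)) hyv
      fun u hu => hy u (Or.inl hu)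
  have hκu : κ (Function.update x v c) = κ (Function.update x' v c) := by
    refine hκc _ _ (by simp) fun u hu => ?_
    by_cases huv : u = v
    · subst huv; simp
    · simpa [huv] using hx u hu
  rw [hfac, hfac, hfac, hfac, hSu, hSu, hκu, hκc x x' hxv hx]
  ring

/-- The Hammersley–Clifford factorisation of the distribution of a one step ahead block. -/
theorem exists_blockProb_eq (hG : G.toMixedGraph.IsEdgeSubgraph Gc.toMixedGraph)
    (hY : IsCausalModel Gc G Y μ) (x₀ : ∀ v, X v) (K : Gc.Block) :
    ∃ ψ : (C : Finset V) → ((u : C) → X u) → ℝ, (∀ C c, 0 < ψ C c) ∧ ∀ x,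
      blockProb μ Y K x = blockProb μ Y K (Function.updateFinset x K.1 (K.1.restrict x₀)) *
        ∏ B ∈ G.blocksIn K.1, ∏ C ∈ G.factorCliques B, ψ C (C.restrict x) := by
  -- Subtracting the value at the reference point makes the interactions of sets outside `K` vanish.
  set f : (∀ v, X v) → ℝ := fun x => Real.log (blockProb μ Y K x) -
    Real.log (blockProb μ Y K (Function.updateFinset x K.1 (K.1.restrict x₀))) with hf
  have hpos := blockProb_pos hY K
  -- The subtracted term does not depend on the values at `K`.
  have hdiff : ∀ v ∈ K.1, ∀ x c, f (Function.update x v c) - f x =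
      Real.log (blockProb μ Y K (Function.update x v c)) - Real.log (blockProb μ Y K x) := by
    intro v hv x c
    have : Function.updateFinset (Function.update x v c) K.1 (K.1.restrict x₀) =
        Function.updateFinset x K.1 (K.1.restrict x₀) := by
      funext u
      by_cases hu : u ∈ K.1
      · simp [Function.updateFinset, hu]
      · have : u ≠ v := fun h => hu (h ▸ hv)
        simp [Function.updateFinset, hu, this]
    simp only [hf, this]
    ring
  have hmixed : ∀ v ∈ K.1, ∀ w, w ≠ v → ¬ (G.undir.Adj v w ∨ G.dir w v) → ∀ x c d,
      f (Function.update (Function.update x w d) v c) - f (Function.update x w d) =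
        f (Function.update x v c) - f x := by
    intro v hv w hwv hw x c d
    rw [hdiff v hv, hdiff v hv]
    have h := blockProb_update_mul hY K hv (x := Function.update x w d) (x' := x)
      (by simp [hwv.symm]) (fun u hu => by
        have : u ≠ w := fun h => hw (h ▸ hu)
        simp [this]) c
    have h' := congrArg Real.log h
    rw [Real.log_mul (hpos _).ne' (hpos _).ne', Real.log_mul (hpos _).ne' (hpos _).ne'] at h'
    linarith
  obtain ⟨ψ, hψ⟩ := exists_sum_restrict x₀ f ((G.blocksIn K.1).biUnion G.factorCliques) (by
    rintro A ⟨x, hx⟩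
    refine exists_factorClique_of_local hG K.2 ?_ ?_
    · by_contra! hAK
      refine hx (Finset.sum_eq_zero fun D hD => ?_)
      have : Function.updateFinset (D.piecewise x x₀) K.1 (K.1.restrict x₀) =
          D.piecewise x x₀ := by
        funext u
        by_cases hu : u ∈ K.1
        · have huD : u ∉ D := fun h => hAK u (Finset.mem_powerset.1 hD h) hu
          simp [Function.updateFinset, hu, huD]
        · simp [Function.updateFinset, hu]
      simp [hf, this]
    · intro v hvA hvK w hwA hwv
      by_contra hw
      refine hx (moebius_eq_zero _ hvA hwA hwv fun D => ?_)
      simp only [Finset.piecewise_insert]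
      exact hmixed v hvK w hwv hw _ _ _)
  refine ⟨fun C c => Real.exp (ψ C c), fun C c => Real.exp_pos _, fun x => ?_⟩
  simp only [← Real.exp_sum]
  rw [← Finset.sum_biUnion, ← hψ]
  · simp only [hf]
    rw [Real.exp_sub, Real.exp_log (hpos _), Real.exp_log (hpos _),
      mul_div_cancel₀ _ (hpos _).ne']
  · intro B hB B' hB' hne
    exact Finset.disjoint_left.2 fun C hC hC' => hne (G.block_unique_of_mem_factorCliques
      (G.mem_blocksIn.1 hB).1 (G.mem_blocksIn.1 hB').1 hC hC')

omit [IsProbabilityMeasure μ] in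
/-- Recursive substitution and independence: the distribution of the observed vector is the product
of the distributions of the one step ahead blocks. -/
theorem measureReal_observed_eq (hY : IsCausalModel Gc G Y μ) (x : ∀ v, X v) :
    μ.real {ω | Gc.observed Y ω = x} = ∏ K : Gc.Block, blockProb μ Y K x := by
  have hset : {ω | Gc.observed Y ω = x} = ⋂ K ∈ (Finset.univ : Finset Gc.Block),
      (fun ω (a : (u : Gc.pa K.1) → X u) => Y K a ω) ⁻¹'
        {y | y ((Gc.pa K.1).restrict x) = K.1.restrict x} := by
    ext ω
    simp only [Set.mem_ofPred_eq, Finset.mem_univ, Set.iInter_true, Set.mem_iInter, Set.mem_preimage]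
    constructor
    · rintro rfl K
      exact (Gc.restrict_observed Y ω K).symm
    · intro h
      funext v
      induction v using Gc.wellFounded_pa.induction with
      | _ v ih =>
        set K : Gc.Block := ⟨Gc.block v, Gc.block_mem_blocks v⟩
        have hpa : (Gc.pa K.1).restrict (Gc.observed Y ω) = (Gc.pa K.1).restrict x :=
          funext fun u => ih u.1 u.2
        have h1 := Gc.restrict_observed Y ω K
        rw [hpa, h K] at h1
        exact congrFun h1 ⟨v, Gc.mem_block_self v⟩
  rw [hset, measureReal_def, hY.indep.measure_inter_preimage_eq_mul Finset.univ]
  · rw [ENNReal.toReal_prod]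
    rfl
  · intro K _
    exact (measurable_pi_apply (X := fun _ : (u : Gc.pa K.1) → X u => (v : K.1) → X v)
      ((Gc.pa K.1).restrict x)) (measurableSet_singleton (K.1.restrict x))

variable [∀ v, Countable (X v)]

/-- If the distribution of the one step ahead
block is proportional to a product of positive factors, one for each block of `G` in it, where the
factor of one block does not depend on the values at another, then each factor is summable, and
the sums make up the normalising constant. -/
theorem blockProb_eq_prod_div (hG : G.toMixedGraph.IsEdgeSubgraph Gc.toMixedGraph)
    (hY : IsCausalModel Gc G Y μ) (x₀ : ∀ v, X v) (K : Gc.Block)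
    (g : Finset V → (∀ v, X v) → ℝ) (hg : ∀ B x, 0 < g B x)
    (hgB : ∀ B ∈ G.blocksIn K.1, ∀ B' ∈ G.blocksIn K.1, B ≠ B' → ∀ x b,
      g B (Function.updateFinset x B' b) = g B x)
    (hfac : ∀ x, blockProb μ Y K x =
      blockProb μ Y K (Function.updateFinset x K.1 (K.1.restrict x₀)) *
        ∏ B ∈ G.blocksIn K.1, g B x) (x : ∀ v, X v) :
    (∀ B ∈ G.blocksIn K.1,
      Summable fun b : (v : B) → X v => g B (Function.updateFinset x B b)) ∧
    blockProb μ Y K x = ∏ B ∈ G.blocksIn K.1,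
      (1 / (∑' b : (v : B) → X v, g B (Function.updateFinset x B b)) * g B x) := by
  set c : (∀ v, X v) → ℝ := fun x =>
    blockProb μ Y K (Function.updateFinset x K.1 (K.1.restrict x₀)) with hc
  have hcpos : ∀ x, 0 < c x := fun x => blockProb_pos hY K _
  have hK := Gc.disjoint_pa K.2
  have hcu : ∀ B ∈ G.blocksIn K.1, ∀ x b, c (Function.updateFinset x B b) = c x := by
    intro B hB x b
    simp only [hc]
    congr 1
    funext u
    by_cases hu : u ∈ K.1
    · simp [Function.updateFinset, hu]
    · have : u ∉ B := fun h => hu ((G.mem_blocksIn.1 hB).2 h)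
      simp [Function.updateFinset, hu, this]
  -- `E W x` is the probability of agreement with `x` off `W`, and `Z B x` the normalising sum of `B`.
  set E : Finset V → (∀ v, X v) → ℝ := fun W x =>
    μ.real {ω | ∀ u : K.1, (u : V) ∉ W → Y K ((Gc.pa K.1).restrict x) ω u = x u} with hE
  set Z : Finset V → (∀ v, X v) → ℝ := fun B x =>
    ∑' b : (v : B) → X v, g B (Function.updateFinset x B b) with hZ
  have hmarg : ∀ (W B : Finset V), B ∈ G.blocksIn K.1 → Disjoint B W → ∀ x : ∀ v, X v,
      HasSum (fun b : (v : B) → X v => E W (Function.updateFinset x B b)) (E (W ∪ B) x) := by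
    intro W B hB hd x
    have hBK := (G.mem_blocksIn.1 hB).2
    have h := hasSum_marginal (μ := μ) (hY.measurable K ((Gc.pa K.1).restrict x)) hBK hd x
    have hpa : Disjoint (Gc.pa K.1) B := hK.mono_right hBK
    simpa only [hE, restrict_updateFinset_of_disjoint hpa] using h
  have hE0 : ∀ x, E ∅ x = blockProb μ Y K x := by
    intro x
    simp only [hE, blockProb]
    congr 1
    ext ω
    simp [funext_iff]
  have hdisj : ∀ B ∈ G.blocksIn K.1, ∀ B' ∈ G.blocksIn K.1, B ≠ B' → Disjoint B B' :=
    fun B hB B' hB' => G.blocks_disjoint (G.mem_blocksIn.1 hB).1 (G.mem_blocksIn.1 hB').1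
  have hZB : ∀ B ∈ G.blocksIn K.1, ∀ B' ∈ G.blocksIn K.1, B ≠ B' → ∀ x b,
      Z B (Function.updateFinset x B' b) = Z B x := by
    intro B hB B' hB' hne x b
    refine tsum_congr fun b' => ?_
    rw [← hgB B hB B' hB' hne (Function.updateFinset x B b') b]
    congr 1
    funext u
    by_cases hu : u ∈ B
    · have := Finset.disjoint_left.1 (hdisj B hB B' hB' hne) hu
      simp [Function.updateFinset, hu, this]
    · by_cases hu' : u ∈ B' <;> simp [Function.updateFinset, hu, hu']
  -- The sum over the values of one more block `B`, all factors but that of `B` being constant.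
  have hstep : ∀ (𝒮 : Finset (Finset V)) (B : Finset V), 𝒮 ⊆ G.blocksIn K.1 →
      B ∈ G.blocksIn K.1 → B ∉ 𝒮 →
      (∀ x, E (𝒮.biUnion id) x =
        c x * (∏ B ∈ 𝒮, Z B x) * ∏ B ∈ G.blocksIn K.1 \ 𝒮, g B x) → ∀ x,
      HasSum (fun b : (v : B) → X v =>
        (c x * (∏ B ∈ 𝒮, Z B x) * ∏ B ∈ G.blocksIn K.1 \ insert B 𝒮, g B x) *
          g B (Function.updateFinset x B b)) (E ((insert B 𝒮).biUnion id) x) := by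
    intro 𝒮 B h𝒮 hB hB𝒮 ih x
    have hd : Disjoint B (𝒮.biUnion id) := (Finset.disjoint_biUnion_right _ _ _).2 fun B' hB' =>
      hdisj B hB B' (h𝒮 hB') fun h => hB𝒮 (h ▸ hB')
    have h := hmarg _ B hB hd x
    rw [Finset.biUnion_insert, Finset.union_comm, id]
    convert h using 2 with b
    have hsplit : G.blocksIn K.1 \ 𝒮 = insert B (G.blocksIn K.1 \ insert B 𝒮) := by
      ext B'
      simp only [Finset.mem_sdiff, Finset.mem_insert]
      by_cases h : B' = B
      · subst h; simp [hB, hB𝒮]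
      · simp [h]
    rw [ih, hcu B hB, hsplit, Finset.prod_insert (by simp),
      Finset.prod_congr rfl fun B' hB' => hZB B' (h𝒮 hB') B hB (fun h => hB𝒮 (h ▸ hB')) x b,
      Finset.prod_congr rfl fun B' hB' => hgB B' (Finset.mem_sdiff.1 hB').1 B hB
        (fun h => (Finset.mem_sdiff.1 hB').2 (h ▸ Finset.mem_insert_self _ _)) x b]
    ring
  have hE0' : ∀ x, E ((∅ : Finset (Finset V)).biUnion id) x =
      c x * (∏ B ∈ (∅ : Finset (Finset V)), Z B x) * ∏ B ∈ G.blocksIn K.1 \ ∅, g B x := by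
    intro x
    rw [Finset.biUnion_empty, hE0, Finset.prod_empty, mul_one, Finset.sdiff_empty, hfac]
  have hall : ∀ 𝒮 ⊆ G.blocksIn K.1, ∀ x, E (𝒮.biUnion id) x =
      c x * (∏ B ∈ 𝒮, Z B x) * ∏ B ∈ G.blocksIn K.1 \ 𝒮, g B x := by
    intro 𝒮
    induction 𝒮 using Finset.induction_on with
    | empty => exact fun _ => hE0'
    | insert B 𝒮 hB ih =>
      intro h x
      obtain ⟨hB', h𝒮⟩ := Finset.insert_subset_iff.1 h
      rw [← (hstep 𝒮 B h𝒮 hB' hB (ih h𝒮) x).tsum_eq, tsum_mul_left, Finset.prod_insert hB]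
      ring
  have hsum : ∀ B ∈ G.blocksIn K.1,
      Summable fun b : (v : B) → X v => g B (Function.updateFinset x B b) := by
    intro B hB
    refine (summable_mul_left_iff ?_).1
      (hstep ∅ B (Finset.empty_subset _) hB (Finset.notMem_empty _) hE0' x).summable
    rw [Finset.prod_empty, mul_one]
    exact (mul_pos (hcpos x) (Finset.prod_pos fun B _ => hg B x)).ne'
  refine ⟨hsum, ?_⟩
  -- Once all blocks are summed out, no condition is left.
  have hone : c x * ∏ B ∈ G.blocksIn K.1, Z B x = 1 := by
    have h := hall _ subset_rfl x
    rw [Finset.sdiff_self, Finset.prod_empty, mul_one] at h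
    rw [← h]
    have : {ω | ∀ u : K.1, (u : V) ∉ (G.blocksIn K.1).biUnion id →
        Y K ((Gc.pa K.1).restrict x) ω u = x u} = Set.univ := by
      refine Set.eq_univ_of_forall fun ω u hu => absurd ?_ hu
      exact Finset.mem_biUnion.2 ⟨_, block_mem_blocksIn hG K.2 u.2, G.mem_block_self _⟩
    simp only [hE, this, probReal_univ]
  rw [hfac x, Finset.prod_mul_distrib]
  congr 1
  simp only [one_div, Finset.prod_inv_distrib]
  exact eq_inv_of_mul_eq_one_left hone

end Model

end ChainGraph

theorem lemma4 {V : Type*} [Fintype V] [DecidableEq V]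
    {X : V → Type*} [∀ v, Countable (X v)] [∀ v, MeasurableSpace (X v)]
    [∀ v, MeasurableSingletonClass (X v)]
    {Ω : Type*} [MeasurableSpace Ω] (μ : Measure Ω) [IsProbabilityMeasure μ]
    (Gc G : ChainGraph V) (hGc : Gc.IsComplete)
    (hG : G.toMixedGraph.IsEdgeSubgraph Gc.toMixedGraph)
    (Y : ChainGraph.OneStepAhead Gc X Ω)
    (hY : ChainGraph.IsCausalModel Gc G Y μ) :
    ∃ (Z : (B : Finset V) → ((u : G.pa B) → X u) → ℝ)
      (φ : (C : Finset V) → ((u : C) → X u) → ℝ),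
      (∀ C c, 0 ≤ φ C c) ∧
      (∀ B ∈ G.blocks, ∀ a, 0 < Z B a) ∧
      (∀ B ∈ G.blocks, ∀ x : (v : V) → X v,
        HasSum
          (fun b : (v : B) → X v =>
            ∏ C ∈ G.factorCliques B, φ C (C.restrict (Function.updateFinset x B b)))
          (Z B ((G.pa B).restrict x))) ∧
      ∀ x : (v : V) → X v,
        μ.real {ω | Gc.observed Y ω = x} =
          ∏ B ∈ G.blocks, (1 / Z B ((G.pa B).restrict x) *
            ∏ C ∈ G.factorCliques B, φ C (C.restrict x)) := by
  classical
  -- Any observed value serves as the reference configuration; in particular, one exists.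
  obtain ⟨ω⟩ : Nonempty Ω := μ.nonempty_of_neZero
  set x₀ := Gc.observed Y ω
  choose ψ hψpos hψ using ChainGraph.exists_blockProb_eq hG hY x₀
  -- The block of `Gc` in the first case is unique, since `C` determines `B` and `B` determines `K`.
  set φ : (C : Finset V) → ((u : C) → X u) → ℝ := fun C c =>
    if h : ∃ K : Gc.Block, ∃ B ∈ G.blocksIn K.1, C ∈ G.factorCliques B then ψ h.choose C c
    else 1 with hφdef
  have hφpos : ∀ C c, 0 < φ C c := by
    intro C c
    simp only [hφdef]
    split_ifs
    · exact hψpos _ _ _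
    · exact one_pos
  have hφ : ∀ K : Gc.Block, ∀ B ∈ G.blocksIn K.1, ∀ C ∈ G.factorCliques B, φ C = ψ K C := by
    intro K B hB C hC
    have h : ∃ K : Gc.Block, ∃ B ∈ G.blocksIn K.1, C ∈ G.factorCliques B := ⟨K, B, hB, hC⟩
    obtain ⟨B', hB', hC'⟩ := h.choose_spec
    have hBB' : B' = B := G.block_unique_of_mem_factorCliques (G.mem_blocksIn.1 hB').1
      (G.mem_blocksIn.1 hB).1 hC' hC
    have hK : h.choose = K := ChainGraph.eq_of_mem_blocksIn (hBB' ▸ hB') hB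
    funext c
    simp only [hφdef]
    rw [dif_pos h, hK]
  set g : Finset V → (∀ v, X v) → ℝ := fun B x => ∏ C ∈ G.factorCliques B, φ C (C.restrict x)
    with hgdef
  have hgpos : ∀ B x, 0 < g B x := fun B x => Finset.prod_pos fun C _ => hφpos _ _
  have hgfa : ∀ B x x', (∀ u ∈ G.fa B, x u = x' u) → g B x = g B x' := by
    intro B x x' h
    refine Finset.prod_congr rfl fun C hC => congrArg _ ?_
    exact funext fun u => h u (G.subset_fa_of_mem_factorCliques hC u.2)
  have hblock : ∀ (K : Gc.Block) (x : ∀ v, X v), _ := fun K x =>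
    ChainGraph.blockProb_eq_prod_div hG hY x₀ K g hgpos (by
      intro B hB B' hB' hne x b
      refine hgfa B _ _ fun u hu => ?_
      have hu' : u ∉ B' := fun hu' => by
        rcases Finset.mem_union.1 hu with h | h
        · exact Finset.disjoint_left.1 (Gc.disjoint_pa K.2)
            (ChainGraph.pa_subset_pa hG (G.mem_blocksIn.1 hB).2 h) ((G.mem_blocksIn.1 hB').2 hu')
        · exact Finset.disjoint_left.1 (G.blocks_disjoint (G.mem_blocksIn.1 hB).1
            (G.mem_blocksIn.1 hB').1 hne) h hu'
      simp [Function.updateFinset, hu']) (by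
      intro x
      rw [hψ K x]
      congr 1
      refine Finset.prod_congr rfl fun B hB => Finset.prod_congr rfl fun C hC => ?_
      rw [hφ K B hB C hC]) x
  have hsum : ∀ B ∈ G.blocks, ∀ x : ∀ v, X v,
      Summable fun b : (v : B) → X v => g B (Function.updateFinset x B b) := by
    intro B hB x
    obtain ⟨v, hv⟩ := G.blocks_nonempty hB
    have hBK := ChainGraph.block_mem_blocksIn hG (Gc.block_mem_blocks v) (Gc.mem_block_self v)
    rw [G.block_eq_of_mem hB hv] at hBK
    exact (hblock ⟨_, Gc.block_mem_blocks v⟩ x).1 B hBK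
  -- The values outside the family of `B` do not matter, and are set to the reference.
  set Z : (B : Finset V) → ((u : G.pa B) → X u) → ℝ := fun B a =>
    ∑' b : (v : B) → X v,
      g B (Function.updateFinset (Function.updateFinset x₀ (G.pa B) a) B b) with hZdef
  have hZ : ∀ B x, Z B ((G.pa B).restrict x) =
      ∑' b : (v : B) → X v, g B (Function.updateFinset x B b) := by
    intro B x
    refine tsum_congr fun b => hgfa B _ _ fun u hu => ?_
    by_cases huB : u ∈ B
    · simp [Function.updateFinset, huB]
    · have hup : u ∈ G.pa B := (Finset.mem_union.1 hu).resolve_right huB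
      simp [Function.updateFinset, huB, hup]
  refine ⟨Z, φ, fun C c => (hφpos C c).le, fun B hB a => ?_, fun B hB x => ?_, fun x => ?_⟩
  · exact (hsum B hB _).tsum_pos (fun b => (hgpos B _).le) (B.restrict x₀) (hgpos B _)
  · rw [hZ]
    exact (hsum B hB x).hasSum
  · rw [ChainGraph.measureReal_observed_eq hY, ChainGraph.prod_blocks hG]
    refine Finset.prod_congr rfl fun K _ => ?_
    rw [(hblock K x).2]
    exact Finset.prod_congr rfl fun B _ => by rw [hZ]
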